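/- Rational tangles are the tangle $[\infty]=1/[0]$ and the tangles $[a_1\,a_2\cdots a_m]=[a_m]+\cfrac{1}{[a_{m-1}]+\cdots+\cfrac{1}{[a_1]}}$ with $m\ge 1$ and $a_i\in\mathbb Z$. Here $[n]$ consists of two horizontal strands wound around each other with $|n|$ crossings, the upper strand at each crossing having positive slope if $n>0$ and negative slope if $n<0$; $S+T$ is the horizontal sum with $S$ on the left; and $1/T$ is the mirror image of $T$ in the diagonal through NW and SE. The fraction $F(R)\in\mathbb Q\cup\{\infty\}$ is the value of the corresponding continued fraction, with $1/0=\infty$, $1/\infty=0$, $a+\infty=\infty$ and $F([\infty])=\infty$. The parity of a reduced fraction $p/q$ (with $\infty=1/0$) is the pair of parities of $p$ and $q$, where $e$ stands for even and $o$ for odd. Let the solid torus be a thickened annulus. Embed the disc of projection of $R$ in the annulus, and let $\overline R$ be the link in the solid torus obtained by joining the top end points of $R$ to its bottom end points by two parallel arcs around the annulus (NW to SW, NE to SE). The homotopy type of a link is its class under homotopy of its unoriented, unordered components, where all crossing changes are allowed. **Corollary.** Let $R$ be a rational tangle and let $L$ be a link in the solid torus that is ambient isotopic to $\overline R$. Then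 1. $L$ is a two-component link of the homotopy type of two parallel copies of the core of the annulus if and only if $F(R)$ has parity $o/e$; 2. $L$ is a knot of the homotopy type of the trivial knot (the boundary of a small disc) if and only if $F(R)$ has parity $e/o$; 3. $L$ is a knot of the homotopy type of the closed crossing $\overline{[1]}$ (a knot running twice around the annulus) if and only if $F(R)$ has parity $o/o$. If $\overline R$ is instead formed by joining the left end points of $R$ to its right end points around the annulus (NW to NE, SW to SE), then 1–3 hold with the parities $o/e$ and $e/o$ interchanged. -/

import Mathlib

open scoped Real

noncomputable section

namespace SolidTorus

/-! ### Tangles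

A tangle lives in the cube `[-1/2, 1/2]³` with coordinates `(x, y, z)`: the `(x, y)`-plane is the
plane of projection and `z` is the height above it. The four end points are the corners
`NW = (-1/2, 1/2, 0)`, `NE = (1/2, 1/2, 0)`, `SW = (-1/2, -1/2, 0)`, `SE = (1/2, -1/2, 0)`.
A tangle is recorded as the point set formed by its strands. -/

/-- Point sets in three-space. -/
abbrev Tangle : Type := Set (ℝ × ℝ × ℝ)

/-- The integer tangle `[n]`: two horizontal strands wound around each other with `|n|` crossings.
The strand `ε = 1` starts at `SW`, the strand `ε = -1` at `NW`. At each crossing the upper strand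
has positive slope if `0 < n`, and negative slope if `n < 0`. -/
def intTangle (n : ℤ) : Tangle :=
  {p | ∃ t ∈ Set.Icc (0 : ℝ) 1, ∃ ε : ℝ, (ε = 1 ∨ ε = -1) ∧
    p = (t - 1 / 2, -ε * Real.cos (π * n * t) / 2, ε * Real.sin (π * n * t) / 2)}

/-- The sum `S + T`: `S` on the left, `T` on the right, each compressed to half of its width, so
that the right end points of `S` meet the left end points of `T`. -/
def tangleAdd (S T : Tangle) : Tangle :=
  (fun p : ℝ × ℝ × ℝ => (p.1 / 2 - 1 / 4, p.2.1, p.2.2)) '' S ∪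
  (fun p : ℝ × ℝ × ℝ => (p.1 / 2 + 1 / 4, p.2.1, p.2.2)) '' T

/-- The tangle `1/T`: the mirror image of `T` in the diagonal line through `NW` and `SE`. -/
def tangleInv (T : Tangle) : Tangle :=
  (fun p : ℝ × ℝ × ℝ => (-p.2.1, -p.1, p.2.2)) '' T

/-- The tangle `T` turned by a quarter turn (counterclockwise) in the plane of projection. -/
def tangleTurn (T : Tangle) : Tangle :=
  (fun p : ℝ × ℝ × ℝ => (-p.2.1, p.1, p.2.2)) '' T

/-- Rational tangles: the tangle `[∞]`, and the tangles `[a₁ a₂ … aₘ]` of nonempty finite sequences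
of integers, where `seq a₁ [a₂, …, aₘ]` stands for `[a₁ a₂ … aₘ]`. -/
inductive RationalTangle : Type
  | infty : RationalTangle
  | seq (a₁ : ℤ) (l : List ℤ) : RationalTangle

/-- The strands of a rational tangle: `[∞] = 1/[0]`, and
`[a₁ … aₘ] = [aₘ] + 1/([aₘ₋₁] + 1/( ⋯ + 1/[a₁]))`. -/
def RationalTangle.toTangle : RationalTangle → Tangle
  | infty => tangleInv (intTangle 0)
  | seq a₁ l => l.foldl (fun T a => tangleAdd (intTangle a) (tangleInv T)) (intTangle a₁)

/-! ### Fractions and their parity -/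

/-- Inversion on `ℚ ∪ {∞}`, with `1/0 = ∞` and `1/∞ = 0`. -/
def fracInv (r : OnePoint ℚ) : OnePoint ℚ :=
  OnePoint.elim r ((0 : ℚ) : OnePoint ℚ)
    (fun s : ℚ => if s = 0 then OnePoint.infty else ((s⁻¹ : ℚ) : OnePoint ℚ))

/-- Addition of an integer on `ℚ ∪ {∞}`, with `a + ∞ = ∞`. -/
def fracAdd (a : ℤ) (r : OnePoint ℚ) : OnePoint ℚ :=
  OnePoint.map (fun s : ℚ => (a : ℚ) + s) r

/-- The fraction: `F([∞]) = ∞` and `F([a₁ … aₘ]) = aₘ + 1/(aₘ₋₁ + 1/( ⋯ + 1/a₁))`, computed in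
`ℚ ∪ {∞}`. -/
def RationalTangle.fraction : RationalTangle → OnePoint ℚ
  | infty => OnePoint.infty
  | seq a₁ l => l.foldl (fun r a => fracAdd a (fracInv r)) (((a₁ : ℚ)) : OnePoint ℚ)

/-- Numerator of the reduced fraction, where `∞ = 1/0`. -/
def fracNum (r : OnePoint ℚ) : ℤ := OnePoint.elim r 1 (fun s : ℚ => s.num)

/-- Denominator of the reduced fraction, where `∞ = 1/0`. -/
def fracDen (r : OnePoint ℚ) : ℕ := OnePoint.elim r 0 (fun s : ℚ => s.den)

/-- Parity `o/e`. -/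
def ParityOE (r : OnePoint ℚ) : Prop := Odd (fracNum r) ∧ Even (fracDen r)

/-- Parity `e/o`. -/
def ParityEO (r : OnePoint ℚ) : Prop := Even (fracNum r) ∧ Odd (fracDen r)

/-- Parity `o/o`. -/
def ParityOO (r : OnePoint ℚ) : Prop := Odd (fracNum r) ∧ Odd (fracDen r)

/-! ### The solid torus and closures of tangles -/

/-- The solid torus `S¹ × D²`. It is a thickening of the annulus formed by the points `(u, w)` with
`w` real; the imaginary part of `w` is the height above the annulus. -/
abbrev V : Type := Circle × Metric.closedBall (0 : ℂ) 1

/-- The closure of `T` that joins the top end points to the bottom end points by two parallel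
arcs around the annulus (`NW` to `SW` and `NE` to `SE`). The cube is embedded by
`(x, y, z) ↦ (exp (iπy), x + iz)`, and the arcs run over the remaining half of the circle. -/
def verticalClosure (T : Tangle) : Set V :=
  {v | (∃ p ∈ T, v.1 = Circle.exp (π * p.2.1) ∧ (v.2 : ℂ) = ⟨p.1, p.2.2⟩) ∨
    (∃ θ ∈ Set.Icc (π / 2) (3 * π / 2),
      v.1 = Circle.exp θ ∧ ((v.2 : ℂ) = -1 / 2 ∨ (v.2 : ℂ) = 1 / 2))}

/-- The closure of `T` that joins the left end points to the right end points by two parallel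
arcs around the annulus (`NW` to `NE` and `SW` to `SE`). -/
def horizontalClosure (T : Tangle) : Set V := verticalClosure (tangleTurn T)

/-- Ambient isotopy of subsets of the solid torus. -/
def AmbientIsotopic (L L' : Set V) : Prop :=
  ∃ Φ : unitInterval → V ≃ₜ V, Continuous (fun q : unitInterval × V => Φ q.1 q.2) ∧
    Φ 0 = Homeomorph.refl V ∧ Φ 1 '' L = L'

/-! ### Homotopy types of links -/

/-- `L` is an `n`-component link (a union of `n` disjoint embedded circles) of the homotopy type
of the `n`-component link `γ₀`: for a suitable ordering and orientation of its components it is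
homotopic to `γ₀`, where strands may cross each other during the homotopy. -/
def IsLinkOfHomotopyType {n : ℕ} (L : Set V) (γ₀ : C(Fin n × Circle, V)) : Prop :=
  ∃ γ : C(Fin n × Circle, V),
    Function.Injective γ ∧ Set.range γ = L ∧ ContinuousMap.Homotopic γ γ₀

theorem half_mem (w : ℂ) (hw : ‖w‖ = 1) : w / 2 ∈ Metric.closedBall (0 : ℂ) 1 := by
  rw [mem_closedBall_zero_iff, norm_div, hw]
  norm_num

theorem sign_norm (i : Fin 2) : ‖((-1 : ℂ) ^ (i : ℕ))‖ = 1 := by simp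

/-- The two-component link formed by two parallel copies of the core of the annulus. -/
def twoCores : C(Fin 2 × Circle, V) where
  toFun q := (q.2, ⟨(-1 : ℂ) ^ (q.1 : ℕ) / 2, half_mem _ (sign_norm q.1)⟩)
  continuous_toFun := by
    refine continuous_snd.prodMk (Continuous.subtype_mk ?_ _)
    exact (continuous_of_discreteTopology
      (f := fun i : Fin 2 => (-1 : ℂ) ^ (i : ℕ) / 2)).comp continuous_fst

/-- The trivial knot: the boundary of a small disc. -/
def trivialKnot : C(Fin 1 × Circle, V) where
  toFun q := (1, ⟨(q.2 : ℂ) / 2, half_mem _ q.2.norm_coe⟩)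
  continuous_toFun := by
    refine continuous_const.prodMk (Continuous.subtype_mk ?_ _)
    fun_prop

/-- The crossing knot: the knot that runs twice around the annulus and whose diagram has a single
crossing, the closure of the tangles `[1]` and `[-1]` up to homotopy. -/
def crossingKnot : C(Fin 1 × Circle, V) where
  toFun q := (q.2 ^ 2, ⟨(q.2 : ℂ) / 2, half_mem _ q.2.norm_coe⟩)
  continuous_toFun := by
    refine (continuous_snd.pow 2).prodMk (Continuous.subtype_mk ?_ _)
    fun_prop

end SolidTorus

end

noncomputable section

namespace SolidTorus

open Topology

/-! The parity of the fraction records how the two strands join the four corners: o/e joins `NW` to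
`SW` and `NE` to `SE`, e/o joins `NW` to `NE` and `SW` to `SE`, o/o joins opposite corners. This is
proved along the continued fraction (`RationalTangle.hasParityType`): the reflection swaps the first
two patterns just as inversion swaps numerator and denominator, and adding an odd integer tangle
swaps the last two patterns just as it changes the parity of the numerator over an odd denominator.

The pattern determines the closure up to homotopy. Following the strands in the covering `ℝ × ℂ`,
where the end points of lifts show the winding, yields two loops of winding 1, one of winding 0, or
one of winding 2 (`IsTangle.isLoops`, `IsTangle.isLoop_horizontal`, `IsTangle.isLoop_crossing`). The
disc factor is convex, so winding numbers fix the homotopy type (`IsLinkOfHomotopyType.of_loops`).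

So each closure has one of the three types. No set has two of them: connectedness separates one
component from two, and the squaring map of the circle is not null-homotopic. With the parities also
exclusive, the implications become equivalences. Ambient isotopy preserves the types, and the other
closure differs by a quarter turn. -/

/-! ### Arcs -/

/-- The set `A` is an arc: it is traced injectively by the image under `p` of a path from `a`
to `b`. -/
def IsArc {X Y : Type*} [TopologicalSpace Y] (p : Y → X) (A : Set X) (a b : Y) : Prop :=
  ∃ f : Path a b, Function.Injective (p ∘ f) ∧ Set.range (p ∘ f) = A

/-- The set `A` is traced by the image under `p` of a path from `a` to `c`, and this image is
injective up to the coincidence of its end points. -/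
def IsClosedArc {X Y : Type*} [TopologicalSpace Y] (p : Y → X) (A : Set X) (a c : Y) : Prop :=
  ∃ f : Path a c, p a = p c ∧ Set.range (p ∘ f) = A ∧
    ∀ s t, p (f s) = p (f t) → s = t ∨ (s = 0 ∧ t = 1) ∨ (s = 1 ∧ t = 0)

section Arc

variable {X Y : Type*} [TopologicalSpace Y] {p : Y → X} {A B : Set X} {a b c : Y}

theorem IsArc.symm (h : IsArc p A a b) : IsArc p A b a := by
  obtain ⟨f, hf, rfl⟩ := h
  refine ⟨f.symm, fun s t hst => ?_, ?_⟩
  · exact unitInterval.symm_involutive.injective (hf hst)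
  · rw [Set.range_comp, f.symm_range, ← Set.range_comp]

theorem IsArc.left_mem (h : IsArc p A a b) : p a ∈ A := by
  obtain ⟨f, -, rfl⟩ := h
  exact ⟨0, by simp⟩

theorem IsArc.right_mem (h : IsArc p A a b) : p b ∈ A := h.symm.left_mem

/-- A point common to the two halves of a concatenated path, over the common end point. -/
theorem Path.trans_mixed (f : Path a b) (g : Path b c) (hg : Function.Injective (p ∘ g))
    (hAB : Set.range (p ∘ f) ∩ Set.range (p ∘ g) ⊆ {p b})
    {s t : unitInterval} (hs : (s : ℝ) ≤ 1 / 2) (ht : ¬ (t : ℝ) ≤ 1 / 2) :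
    p (f.trans g s) ≠ p (f.trans g t) := by
  intro h
  rw [Path.trans_apply, Path.trans_apply, dif_pos hs, dif_neg ht] at h
  have hb := hAB ⟨⟨_, rfl⟩, ⟨_, h.symm⟩⟩
  rw [Set.mem_singleton_iff, Function.comp_apply, h] at hb
  -- The common point is the start of `g`, so injectivity of `g` forces `t = 1 / 2`, which `ht`
  -- excludes.
  have := congrArg Subtype.val (hg (hb.trans (congrArg p g.source.symm)))
  simp at this
  linarith

theorem Path.trans_injective (f : Path a b) (g : Path b c) (hf : Function.Injective (p ∘ f))
    (hg : Function.Injective (p ∘ g))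
    {s t : unitInterval} (hst : (s : ℝ) ≤ 1 / 2 ↔ (t : ℝ) ≤ 1 / 2)
    (h : p (f.trans g s) = p (f.trans g t)) : s = t := by
  rw [Path.trans_apply, Path.trans_apply] at h
  by_cases hs : (s : ℝ) ≤ 1 / 2
  · rw [dif_pos hs, dif_pos (hst.1 hs)] at h
    have := congrArg Subtype.val (hf h)
    ext; simpa using this
  · rw [dif_neg hs, dif_neg (mt hst.2 hs)] at h
    have := congrArg Subtype.val (hg h)
    ext; simpa using this

theorem range_comp_trans (f : Path a b) (g : Path b c) :
    Set.range (p ∘ f.trans g) = Set.range (p ∘ f) ∪ Set.range (p ∘ g) := by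
  rw [Set.range_comp, Path.trans_range, Set.image_union, ← Set.range_comp, ← Set.range_comp]

theorem IsArc.trans (hA : IsArc p A a b) (hB : IsArc p B b c) (hAB : A ∩ B ⊆ {p b}) :
    IsArc p (A ∪ B) a c := by
  obtain ⟨f, hf, rfl⟩ := hA
  obtain ⟨g, hg, rfl⟩ := hB
  refine ⟨f.trans g, fun s t hst => ?_, range_comp_trans f g⟩
  by_cases hs : (s : ℝ) ≤ 1 / 2 <;> by_cases ht : (t : ℝ) ≤ 1 / 2
  · exact Path.trans_injective f g hf hg (by tauto) hst
  · exact absurd hst (Path.trans_mixed f g hg hAB hs ht)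
  · exact absurd hst.symm (Path.trans_mixed f g hg hAB ht hs)
  · exact Path.trans_injective f g hf hg (by tauto) hst

theorem Path.trans_mixed_closed (f : Path a b) (g : Path b c) (hf : Function.Injective (p ∘ f))
    (hg : Function.Injective (p ∘ g)) (hac : p a = p c)
    (hAB : Set.range (p ∘ f) ∩ Set.range (p ∘ g) ⊆ {p a, p b})
    {s t : unitInterval} (hs : (s : ℝ) ≤ 1 / 2) (ht : ¬ (t : ℝ) ≤ 1 / 2)
    (h : p (f.trans g s) = p (f.trans g t)) : s = 0 ∧ t = 1 := by
  rw [Path.trans_apply, Path.trans_apply, dif_pos hs, dif_neg ht] at h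
  rcases hAB ⟨⟨_, rfl⟩, ⟨_, h.symm⟩⟩ with hb | hb
  · constructor
    · have := congrArg Subtype.val (hf (hb.trans (congrArg p f.source.symm)))
      ext; simpa using this
    · rw [Function.comp_apply, h, hac] at hb
      have := congrArg Subtype.val (hg (hb.trans (congrArg p g.target.symm)))
      simp at this
      exact Subtype.ext (show (t : ℝ) = 1 by linarith)
  · rw [Set.mem_singleton_iff, Function.comp_apply, h] at hb
    have := congrArg Subtype.val (hg (hb.trans (congrArg p g.source.symm)))
    simp at this
    linarith

theorem IsArc.close (hA : IsArc p A a b) (hB : IsArc p B b c) (hac : p a = p c)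
    (hAB : A ∩ B ⊆ {p a, p b}) : IsClosedArc p (A ∪ B) a c := by
  obtain ⟨f, hf, rfl⟩ := hA
  obtain ⟨g, hg, rfl⟩ := hB
  refine ⟨f.trans g, hac, range_comp_trans f g, fun s t hst => ?_⟩
  by_cases hs : (s : ℝ) ≤ 1 / 2 <;> by_cases ht : (t : ℝ) ≤ 1 / 2
  · exact .inl (Path.trans_injective f g hf hg (by tauto) hst)
  · exact .inr (.inl (Path.trans_mixed_closed f g hf hg hac hAB hs ht hst))
  · exact .inr (.inr (Path.trans_mixed_closed f g hf hg hac hAB ht hs hst.symm).symm)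
  · exact .inl (Path.trans_injective f g hf hg (by tauto) hst)

/-- The map `j` lifts `k` to the spaces in which the paths live. Injectivity is needed only for `k`,
and only on the arc, so embedding the cube and deck transformations are both covered. -/
theorem IsArc.map {X' Y' : Type*} [TopologicalSpace Y'] {p' : Y' → X'} (h : IsArc p A a b)
    {k : X → X'} (hk : Set.InjOn k A) {j : Y → Y'} (hj : Continuous j)
    (hjk : ∀ y, p' (j y) = k (p y)) : IsArc p' (k '' A) (j a) (j b) := by
  obtain ⟨f, hf, rfl⟩ := h
  refine ⟨f.map hj, fun s t hst => hf (hk ⟨s, rfl⟩ ⟨t, rfl⟩ ?_), ?_⟩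
  · simpa [hjk] using hst
  · rw [← Set.range_comp]
    congr 1
    funext t
    simp [hjk]

end Arc

/-! ### Loops in the solid torus -/

/-- The set `L` is an embedded circle in the solid torus that runs `d` times around the annulus. -/
def IsLoop (L : Set V) (d : ℤ) : Prop :=
  ∃ f : C(Circle, V), Function.Injective f ∧ Set.range f = L ∧
    ∃ g : C(Circle, ℝ), ∀ z, (f z).1 = Circle.exp (g z) * z ^ d

/-- The circle as a quotient of the unit interval. -/
def circlePath : C(unitInterval, Circle) where
  toFun t := Circle.exp (2 * π * t)
  continuous_toFun := by fun_prop

theorem circlePath_eq {s t : unitInterval} (h : circlePath s = circlePath t) :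
    s = t ∨ (s = 0 ∧ t = 1) ∨ (s = 1 ∧ t = 0) := by
  obtain ⟨m, hm⟩ := Circle.exp_eq_exp.1 h
  have hm' : (s : ℝ) = t + m := by
    have := Real.pi_pos
    apply mul_left_cancel₀ (show 2 * π ≠ 0 by positivity)
    linarith
  have h1 := s.2.1
  have h2 := s.2.2
  have h3 := t.2.1
  have h4 := t.2.2
  have : -1 ≤ m := by exact_mod_cast (show (-1 : ℝ) ≤ m by linarith)
  have : m ≤ 1 := by exact_mod_cast (show (m : ℝ) ≤ 1 by linarith)
  interval_cases m
  · right; left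
    norm_num at hm'
    exact ⟨Subtype.ext (show (s : ℝ) = 0 by linarith), Subtype.ext (show (t : ℝ) = 1 by linarith)⟩
  · left; ext; simpa using hm'
  · right; right
    norm_num at hm'
    exact ⟨Subtype.ext (show (s : ℝ) = 1 by linarith), Subtype.ext (show (t : ℝ) = 0 by linarith)⟩

theorem circlePath_surjective : Function.Surjective circlePath := by
  intro z
  have h2 : 0 < 2 * π := Real.two_pi_pos
  refine ⟨⟨toIcoMod h2 0 (Circle.argEquiv z : ℝ) / (2 * π), ?_⟩, ?_⟩
  · have := toIcoMod_mem_Ico h2 0 (Circle.argEquiv z : ℝ)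
    rw [zero_add] at this
    exact ⟨div_nonneg this.1 h2.le, (div_le_one h2).2 this.2.le⟩
  · change Circle.exp (2 * π * (_ / (2 * π))) = z
    rw [mul_div_cancel₀ _ h2.ne']
    conv_rhs => rw [← Circle.exp_arg z]
    rw [Circle.exp_eq_exp]
    refine ⟨-toIcoDiv h2 0 (Circle.argEquiv z : ℝ), ?_⟩
    have := toIcoMod_add_toIcoDiv_zsmul h2 0 (Circle.argEquiv z : ℝ)
    simp only [zsmul_eq_mul] at this
    change _ = (Circle.argEquiv z : ℝ) + _
    push_cast
    linarith

theorem isQuotientMap_circlePath : IsQuotientMap circlePath :=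
  (circlePath.continuous.isClosedMap).isQuotientMap circlePath.continuous circlePath_surjective

/-- The covering of the unbounded solid torus. -/
def cover (q : ℝ × ℂ) : Circle × ℂ := (Circle.exp q.1, q.2)

/-- The embedding of the solid torus in the unbounded solid torus. -/
def inclusion (v : V) : Circle × ℂ := (v.1, v.2)

theorem inclusion_injective : Function.Injective inclusion := by
  rintro ⟨a, b⟩ ⟨c, d⟩ h
  simp only [inclusion, Prod.mk.injEq] at h
  exact Prod.ext h.1 (Subtype.ext h.2)

/-- A path on `[0, 1]` that closes up downstairs descends to the circle; the gain `2 * π * d` in the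
lifted angle is its winding. -/
theorem IsClosedArc.isLoop {A : Set (Circle × ℂ)} {s : ℝ} {w : ℂ} {d : ℤ} {a c : ℝ × ℂ}
    (h : IsClosedArc cover A a c) (hA : ∀ q ∈ A, ‖q.2‖ ≤ 1) (ha : a = (s, w))
    (hc : c = (s + 2 * π * d, w)) :
    IsLoop (inclusion ⁻¹' A) d := by
  subst ha hc
  obtain ⟨f, hac, hr, hf⟩ := h
  have hmem (t) : (f t).2 ∈ Metric.closedBall (0 : ℂ) 1 := by
    rw [mem_closedBall_zero_iff]
    exact hA (cover (f t)) (hr ▸ ⟨t, rfl⟩)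
  let F : C(unitInterval, V) :=
    ⟨fun t => (Circle.exp (f t).1, ⟨(f t).2, hmem t⟩), by fun_prop⟩
  -- Without its linear growth the angle agrees at both ends, so it too descends, to a real function
  -- measuring the deviation from `z ^ d`.
  let G : C(unitInterval, ℝ) := ⟨fun t => (f t).1 - 2 * π * d * t, by fun_prop⟩
  have hF : Function.FactorsThrough F circlePath := by
    intro t t' htt
    rcases circlePath_eq htt with rfl | ⟨rfl, rfl⟩ | ⟨rfl, rfl⟩
    · rfl
    · exact inclusion_injective (by simpa [F, inclusion, cover] using hac)
    · exact inclusion_injective (by simpa [F, inclusion, cover] using hac.symm)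
  have hG : Function.FactorsThrough G circlePath := by
    intro t t' htt
    rcases circlePath_eq htt with rfl | ⟨rfl, rfl⟩ | ⟨rfl, rfl⟩ <;> simp [G]
  have hF' (t) : isQuotientMap_circlePath.lift F hF (circlePath t) = F t :=
    DFunLike.congr_fun (isQuotientMap_circlePath.lift_comp F hF) t
  have hG' (t) : isQuotientMap_circlePath.lift G hG (circlePath t) = G t :=
    DFunLike.congr_fun (isQuotientMap_circlePath.lift_comp G hG) t
  have hin (t) : inclusion (F t) = cover (f t) := rfl
  refine ⟨isQuotientMap_circlePath.lift F hF, ?_, ?_, isQuotientMap_circlePath.lift G hG, ?_⟩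
  · intro z z' hz
    obtain ⟨t, rfl⟩ := circlePath_surjective z
    obtain ⟨t', rfl⟩ := circlePath_surjective z'
    rw [hF', hF'] at hz
    rcases hf t t' (by rw [← hin, hz, hin]) with rfl | ⟨rfl, rfl⟩ | ⟨rfl, rfl⟩
    · rfl
    · simp [circlePath]
    · simp [circlePath]
  · ext v
    constructor
    · rintro ⟨z, rfl⟩
      obtain ⟨t, rfl⟩ := circlePath_surjective z
      rw [hF', Set.mem_preimage, hin, ← hr]
      exact ⟨t, rfl⟩
    · intro hv
      rw [Set.mem_preimage, ← hr] at hv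
      obtain ⟨t, ht⟩ := hv
      exact ⟨circlePath t, by rw [hF']; exact inclusion_injective ht⟩
  · intro z
    obtain ⟨t, rfl⟩ := circlePath_surjective z
    rw [hF', hG']
    change Circle.exp (f t).1 = Circle.exp ((f t).1 - 2 * π * d * t) * Circle.exp (2 * π * t) ^ d
    rw [← Circle.exp_zsmul, ← Circle.exp_add]
    congr 1
    simp only [zsmul_eq_mul]
    ring

/-- The real-valued angular deviation scales to zero while the disc coordinate moves along a segment
of the convex disc. Components may cross on the way, so disjointness matters only for the initial
embedding. -/
theorem IsLinkOfHomotopyType.of_loops {n : ℕ} {ℓ : Fin n → Set V} {d : Fin n → ℤ}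
    (hℓ : ∀ i, IsLoop (ℓ i) (d i)) (hdis : Pairwise (Function.onFun Disjoint ℓ))
    (γ₀ : C(Fin n × Circle, V)) (hγ : ∀ q, (γ₀ q).1 = q.2 ^ d q.1) :
    IsLinkOfHomotopyType (⋃ i, ℓ i) γ₀ := by
  choose f hf hr g hg using hℓ
  have hcont {Z : Type} [TopologicalSpace Z] (k : Fin n → C(Circle, Z)) :
      Continuous fun q : Fin n × Circle => k q.1 q.2 := by
    refine continuous_prod_of_discrete_left.2 fun i => (k i).continuous
  let γ : C(Fin n × Circle, V) := ⟨fun q => f q.1 q.2, hcont f⟩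
  let G : C(Fin n × Circle, ℝ) := ⟨fun q => g q.1 q.2, hcont g⟩
  have hmem (t : unitInterval) (q) :
      (1 - (t : ℝ)) • ((γ q).2 : ℂ) + (t : ℝ) • ((γ₀ q).2 : ℂ) ∈ Metric.closedBall (0 : ℂ) 1 :=
    (convex_closedBall (0 : ℂ) 1) (γ q).2.2 (γ₀ q).2.2 (by linarith [t.2.2]) t.2.1 (by ring)
  refine ⟨γ, ?_, ?_, ⟨⟨⟨fun q => (Circle.exp ((1 - (q.1 : ℝ)) * G q.2) * (γ₀ q.2).1,
    ⟨_, hmem q.1 q.2⟩), ?_⟩, ?_, ?_⟩⟩⟩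
  · rintro ⟨i, z⟩ ⟨j, z'⟩ h
    change f i z = f j z' at h
    have hij : i = j := by
      by_contra hij
      have hi : f i z ∈ ℓ i := hr i ▸ ⟨z, rfl⟩
      have hj : f i z ∈ ℓ j := h ▸ hr j ▸ ⟨z', rfl⟩
      exact Set.disjoint_left.1 (hdis hij) hi hj
    subst hij
    rw [hf i h]
  · ext v
    simp only [Set.mem_iUnion, ← hr]
    constructor
    · rintro ⟨⟨i, z⟩, rfl⟩
      exact ⟨i, z, rfl⟩
    · rintro ⟨i, z, rfl⟩
      exact ⟨(i, z), rfl⟩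
  · fun_prop
  · rintro ⟨i, z⟩
    refine inclusion_injective (Prod.ext ?_ ?_)
    · simp [inclusion, hγ, γ, G, hg]
    · simp [inclusion]
  · rintro ⟨i, z⟩
    refine inclusion_injective (Prod.ext ?_ ?_) <;> simp [inclusion]

/-! ### Invariance and distinction of homotopy types -/

/-- Composed with a parametrization, the isotopy is itself a homotopy from it to the transported
one; for the converse the parametrization is first pulled back by `Φ 1`. -/
theorem AmbientIsotopic.isLinkOfHomotopyType_iff {L L' : Set V} (h : AmbientIsotopic L L') {n : ℕ}
    (γ₀ : C(Fin n × Circle, V)) :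
    IsLinkOfHomotopyType L γ₀ ↔ IsLinkOfHomotopyType L' γ₀ := by
  obtain ⟨Φ, hΦ, h0, rfl⟩ := h
  have h0' (v : V) : Φ 0 v = v := by rw [h0]; rfl
  constructor
  · rintro ⟨γ, hi, hr, hγ⟩
    refine ⟨⟨fun q => Φ 1 (γ q), by fun_prop⟩, (Φ 1).injective.comp hi, ?_, .trans (.symm ?_) hγ⟩
    · rw [← hr, ← Set.range_comp]
      rfl
    · exact ⟨⟨⟨fun q => Φ q.1 (γ q.2),
        hΦ.comp (continuous_fst.prodMk (γ.continuous.comp continuous_snd))⟩,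
        fun q => h0' _, fun q => rfl⟩⟩
  · rintro ⟨γ, hi, hr, hγ⟩
    refine ⟨⟨fun q => (Φ 1).symm (γ q), by fun_prop⟩, (Φ 1).symm.injective.comp hi, ?_,
      .trans ?_ hγ⟩
    · change Set.range ((Φ 1).symm ∘ γ) = L
      rw [Set.range_comp, hr, ← Set.image_comp]
      simp
    · exact ⟨⟨⟨fun q => Φ q.1 ((Φ 1).symm (γ q.2)),
        hΦ.comp (continuous_fst.prodMk
          ((Φ 1).symm.continuous.comp (γ.continuous.comp continuous_snd)))⟩,
        fun q => h0' _, fun q => (Φ 1).apply_symm_apply _⟩⟩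

/-- `L` would be connected as the image of one circle, hence so would `Fin 2 × Circle`, which is
embedded onto `L`. -/
theorem IsLinkOfHomotopyType.false_of_one_two {L : Set V} {γ₀ : C(Fin 1 × Circle, V)}
    {γ₁ : C(Fin 2 × Circle, V)} (h₀ : IsLinkOfHomotopyType L γ₀)
    (h₁ : IsLinkOfHomotopyType L γ₁) : False := by
  obtain ⟨γ, -, hr, -⟩ := h₀
  obtain ⟨γ', hi', hr', -⟩ := h₁
  have hL : IsPreconnected (γ' '' Set.univ) := by
    rw [Set.image_univ, hr', ← hr]
    exact isPreconnected_range γ.continuous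
  have := ((γ'.continuous.isClosedEmbedding hi').isInducing.isPreconnected_image.1 hL).image
    Prod.fst continuous_fst.continuousOn
  have h01 := this.subsingleton (x := 0) (y := 1) ⟨(0, 1), trivial, rfl⟩ ⟨(1, 1), trivial, rfl⟩
  exact absurd h01 (by decide)

/-- The squaring map of the circle is not homotopic to a constant map. -/
theorem not_homotopic_const_sq (f : C(Circle, Circle)) (hf : ∀ z, f z = z ^ 2) :
    ¬ ContinuousMap.Homotopic (ContinuousMap.const Circle (1 : Circle)) f := by
  rintro ⟨H⟩
  let G := Circle.isCoveringMap_exp.liftHomotopy H.toContinuousMap (ContinuousMap.const Circle 0)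
    (fun a => by simp)
  have hG (q) : Circle.exp (G q) = H q :=
    congrFun (Circle.isCoveringMap_exp.liftHomotopy_lifts H.toContinuousMap _ _) q
  -- At time 1 both `G` and `2 * t` are angles of the same point, so `g` is integer-valued and
  -- therefore constant; yet it drops by 2 between `0` and `2 * π`.
  let g : ℝ → ℝ := fun t => (G (1, Circle.exp t) - 2 * t) / (2 * π)
  have hg : Continuous g := by fun_prop
  have hπ : 2 * π ≠ 0 := Real.two_pi_pos.ne'
  have hint (t : ℝ) : ∃ m : ℤ, g t = m := by
    have h1 := hG (1, Circle.exp t)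
    have h2 : H (1, Circle.exp t) = Circle.exp (2 * t) := by
      rw [H.apply_one, hf, ← Circle.exp_nsmul]
      simp
    rw [h2, Circle.exp_eq_exp] at h1
    obtain ⟨m, hm⟩ := h1
    exact ⟨m, by simp only [g, hm]; field_simp; ring⟩
  choose m hm using hint
  have hmc : Continuous m := by
    rw [Int.isClosedEmbedding_coe_real.continuous_iff]
    convert hg using 1
    exact funext fun t => (hm t).symm
  have hconst : m 0 = m (2 * π) := PreconnectedSpace.constant inferInstance hmc
  have : g 0 = g (2 * π) := by rw [hm, hm, hconst]
  simp only [g, Circle.exp_two_pi, Circle.exp_zero] at this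
  field_simp at this
  have := Real.pi_pos
  linarith

/-- Two parametrizations of the same set differ by a self-map `h` of the circle. Since `trivialKnot`
has constant first coordinate, so has `trivialKnot.comp h`, whatever `h` is, and the squaring map
would be null-homotopic. -/
theorem IsLinkOfHomotopyType.false_of_trivial_crossing {L : Set V}
    (h₀ : IsLinkOfHomotopyType L trivialKnot) (h₁ : IsLinkOfHomotopyType L crossingKnot) :
    False := by
  obtain ⟨γ, hi, hr, hγ⟩ := h₀
  obtain ⟨γ', hi', hr', hγ'⟩ := h₁
  have he := (γ.continuous.isClosedEmbedding hi).isEmbedding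
  have hex (q) : ∃ q', γ q' = γ' q := by
    have : γ' q ∈ Set.range γ := by rw [hr, ← hr']; exact ⟨q, rfl⟩
    exact this
  choose h hh using hex
  have hc : Continuous h := by
    rw [he.continuous_iff]
    convert γ'.continuous using 1
    exact funext hh
  let h' : C(Fin 1 × Circle, Fin 1 × Circle) := ⟨h, hc⟩
  have e : γ.comp h' = γ' := ContinuousMap.ext hh
  have H : (trivialKnot.comp h').Homotopic crossingKnot :=
    .trans (.symm (e ▸ hγ.comp (.refl h'))) hγ'
  let pr : C(V, Circle) := ⟨Prod.fst, continuous_fst⟩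
  let inc : C(Circle, Fin 1 × Circle) := ⟨fun z => (0, z), by fun_prop⟩
  exact not_homotopic_const_sq ((pr.comp crossingKnot).comp inc) (fun z => rfl)
    ((ContinuousMap.Homotopic.refl pr |>.comp H).comp (.refl inc))

/-! ### Parities -/

theorem odd_fracInv (r : OnePoint ℚ) :
    (Odd (fracNum (fracInv r)) ↔ Odd (fracDen r)) ∧
      (Odd (fracDen (fracInv r)) ↔ Odd (fracNum r)) := by
  induction r using OnePoint.rec with
  | infty => simp [fracInv, fracNum, fracDen]
  | coe s =>
    by_cases hs : s = 0
    · simp [fracInv, fracNum, fracDen, hs]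
    · have : Odd s.num.sign := by
        rcases lt_trichotomy s.num 0 with h | h | h
        · simp [Int.sign_eq_neg_one_of_neg h]
        · exact absurd (Rat.num_eq_zero.1 h) hs
        · simp [Int.sign_eq_one_of_pos h]
      simp [fracInv, fracNum, fracDen, hs, Int.odd_mul, this]

/-- Adding an integer keeps the fraction reduced over the same denominator; at `∞` the denominator
is 0, so `a` has no effect. -/
theorem odd_fracAdd (a : ℤ) (r : OnePoint ℚ) :
    (Odd (fracNum (fracAdd a r)) ↔ (Odd (fracNum r) ↔ ¬ (Odd a ∧ Odd (fracDen r)))) ∧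
      (Odd (fracDen (fracAdd a r)) ↔ Odd (fracDen r)) := by
  induction r using OnePoint.rec with
  | infty => simp [fracAdd, fracNum, fracDen]
  | coe s =>
    have hd : ((a : ℚ) + s).den = s.den := Rat.intCast_add_den a s
    have hn : ((a : ℚ) + s).num = a * s.den + s.num := by
      have h : (((a : ℚ) + s).num : ℚ) = a * s.den + s.num := by
        rw [← Rat.mul_den_eq_num, hd, add_mul, Rat.mul_den_eq_num]
      exact_mod_cast h
    change (Odd ((a : ℚ) + s).num ↔ (Odd s.num ↔ ¬ (Odd a ∧ Odd s.den))) ∧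
      (Odd ((a : ℚ) + s).den ↔ Odd s.den)
    rw [hn, hd, Int.odd_add', ← Int.not_odd_iff_even, Int.odd_mul, Int.odd_coe_nat]
    tauto

/-! ### Tangles with two strands -/

def NW : ℝ × ℝ × ℝ := (-1 / 2, 1 / 2, 0)
def NE : ℝ × ℝ × ℝ := (1 / 2, 1 / 2, 0)
def SW : ℝ × ℝ × ℝ := (-1 / 2, -1 / 2, 0)
def SE : ℝ × ℝ × ℝ := (1 / 2, -1 / 2, 0)

/-- The cube that contains the tangles. -/
def cube : Set (ℝ × ℝ × ℝ) := {p | |p.1| ≤ 1 / 2 ∧ |p.2.1| ≤ 1 / 2 ∧ |p.2.2| ≤ 1 / 2}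

/-- `T` consists of two disjoint strands in the cube, from `a` to `b` and from `c` to `d`. -/
def IsTangle (T : Tangle) (a b c d : ℝ × ℝ × ℝ) : Prop :=
  T ⊆ cube ∧ ∃ A B, IsArc id A a b ∧ IsArc id B c d ∧ Disjoint A B ∧ A ∪ B = T

theorem IsTangle.swap {T : Tangle} {a b c d : ℝ × ℝ × ℝ} (h : IsTangle T a b c d) :
    IsTangle T c d a b := by
  obtain ⟨hT, A, B, hA, hB, hAB, rfl⟩ := h
  exact ⟨hT, B, A, hB, hA, hAB.symm, Set.union_comm _ _⟩

theorem IsTangle.symm_left {T : Tangle} {a b c d : ℝ × ℝ × ℝ} (h : IsTangle T a b c d) :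
    IsTangle T b a c d := by
  obtain ⟨hT, A, B, hA, hB, hAB, rfl⟩ := h
  exact ⟨hT, A, B, hA.symm, hB, hAB, rfl⟩

theorem IsTangle.symm_right {T : Tangle} {a b c d : ℝ × ℝ × ℝ} (h : IsTangle T a b c d) :
    IsTangle T a b d c := h.swap.symm_left.swap

theorem IsTangle.image {T : Tangle} {a b c d : ℝ × ℝ × ℝ} (h : IsTangle T a b c d)
    {k : ℝ × ℝ × ℝ → ℝ × ℝ × ℝ} (hk : Continuous k) (hi : Function.Injective k)
    (hc : Set.MapsTo k cube cube) : IsTangle (k '' T) (k a) (k b) (k c) (k d) := by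
  obtain ⟨hT, A, B, hA, hB, hAB, rfl⟩ := h
  refine ⟨(hc.mono_left hT).image_subset, k '' A, k '' B, hA.map hi.injOn hk fun _ => rfl,
    hB.map hi.injOn hk fun _ => rfl, hAB.image hi.injOn (Set.subset_univ _) (Set.subset_univ _),
    (Set.image_union _ _ _).symm⟩

theorem IsTangle.inv {T : Tangle} {a b c d : ℝ × ℝ × ℝ} (h : IsTangle T a b c d) :
    IsTangle (tangleInv T) (-a.2.1, -a.1, a.2.2) (-b.2.1, -b.1, b.2.2) (-c.2.1, -c.1, c.2.2)
      (-d.2.1, -d.1, d.2.2) := by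
  refine h.image (k := fun p => (-p.2.1, -p.1, p.2.2)) (by fun_prop) ?_ ?_
  · rintro ⟨x, y, z⟩ ⟨x', y', z'⟩ h
    simp only [Prod.mk.injEq, neg_inj] at h ⊢
    tauto
  · rintro ⟨x, y, z⟩ ⟨hx, hy, hz⟩
    simp only [cube, Set.mem_ofPred_eq, abs_neg]
    exact ⟨hy, hx, hz⟩

theorem IsTangle.turn {T : Tangle} {a b c d : ℝ × ℝ × ℝ} (h : IsTangle T a b c d) :
    IsTangle (tangleTurn T) (-a.2.1, a.1, a.2.2) (-b.2.1, b.1, b.2.2) (-c.2.1, c.1, c.2.2)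
      (-d.2.1, d.1, d.2.2) := by
  refine h.image (k := fun p => (-p.2.1, p.1, p.2.2)) (by fun_prop) ?_ ?_
  · rintro ⟨x, y, z⟩ ⟨x', y', z'⟩ h
    simp only [Prod.mk.injEq, neg_inj] at h ⊢
    tauto
  · rintro ⟨x, y, z⟩ ⟨hx, hy, hz⟩
    simp only [cube, Set.mem_ofPred_eq, abs_neg]
    exact ⟨hy, hx, hz⟩

/-- The strand `ε` of the integer tangle `[n]`. -/
def intStrand (n : ℤ) (ε : ℝ) : Set (ℝ × ℝ × ℝ) :=
  {p | ∃ t ∈ Set.Icc (0 : ℝ) 1,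
    p = (t - 1 / 2, -ε * Real.cos (π * n * t) / 2, ε * Real.sin (π * n * t) / 2)}

theorem isArc_intStrand (n : ℤ) (ε : ℝ) :
    IsArc id (intStrand n ε) (-1 / 2, -ε / 2, 0) (1 / 2, -ε * (-1) ^ n / 2, 0) := by
  have hs : Real.sin (π * n) = 0 := by rw [mul_comm]; exact Real.sin_int_mul_pi n
  have hc : Real.cos (π * n) = (-1) ^ n := by rw [mul_comm]; exact Real.cos_int_mul_pi n
  refine ⟨⟨⟨fun t => ((t : ℝ) - 1 / 2, -ε * Real.cos (π * n * t) / 2,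
    ε * Real.sin (π * n * t) / 2), by fun_prop⟩, ?_, ?_⟩, ?_, ?_⟩
  · norm_num
  · norm_num [hs, hc]
  · intro s t h
    simp only [Path.coe_mk_mk, Function.comp_apply, id, Prod.mk.injEq, sub_left_inj] at h
    exact Subtype.ext h.1
  · ext p
    constructor
    · rintro ⟨t, rfl⟩
      exact ⟨t, t.2, rfl⟩
    · rintro ⟨t, ht, rfl⟩
      exact ⟨⟨t, ht⟩, rfl⟩

theorem isTangle_intTangle (n : ℤ) :
    IsTangle (intTangle n) NW (1 / 2, (-1) ^ n / 2, 0) SW (1 / 2, -(-1) ^ n / 2, 0) := by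
  refine ⟨?_, intStrand n (-1), intStrand n 1, ?_, ?_, ?_, ?_⟩
  · rintro _ ⟨t, ht, ε, hε, rfl⟩
    have hε' : |ε| = 1 := by rcases hε with rfl | rfl <;> simp
    have h2 : |(2 : ℝ)| = 2 := abs_two
    refine ⟨abs_le.2 ⟨by linarith [ht.1], by linarith [ht.2]⟩, ?_, ?_⟩ <;>
      simp only [abs_div, abs_mul, abs_neg, hε', h2, one_mul]
    · linarith [Real.abs_cos_le_one (π * n * t)]
    · linarith [Real.abs_sin_le_one (π * n * t)]
  · convert isArc_intStrand n (-1) using 1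
    · simp [NW]
    · simp
  · convert isArc_intStrand n 1 using 1
    · simp [SW]
    · simp
  -- At equal first coordinate the two strands are at antipodal points of a circle, so a common
  -- point would make sine and cosine vanish together.
  · refine Set.disjoint_left.2 ?_
    rintro _ ⟨t, -, rfl⟩ ⟨s, -, h⟩
    simp only [Prod.mk.injEq, sub_left_inj] at h
    obtain ⟨rfl, h1, h2⟩ := h
    have h3 := Real.sin_sq_add_cos_sq (π * n * t)
    have h4 : Real.cos (π * n * t) = 0 := by linarith
    have h5 : Real.sin (π * n * t) = 0 := by linarith
    rw [h4, h5] at h3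
    norm_num at h3
  · ext p
    constructor
    · rintro (⟨t, ht, rfl⟩ | ⟨t, ht, rfl⟩)
      · exact ⟨t, ht, -1, .inr rfl, rfl⟩
      · exact ⟨t, ht, 1, .inl rfl, rfl⟩
    · rintro ⟨t, ht, ε, rfl | rfl, rfl⟩
      · exact .inr ⟨t, ht, rfl⟩
      · exact .inl ⟨t, ht, rfl⟩

theorem isTangle_intTangle_even {n : ℤ} (hn : Even n) : IsTangle (intTangle n) NW NE SW SE := by
  simpa [hn.neg_one_zpow, NE, SE] using isTangle_intTangle n

theorem isTangle_intTangle_odd {n : ℤ} (hn : Odd n) : IsTangle (intTangle n) NW SE SW NE := by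
  simpa [hn.neg_one_zpow, NE, SE] using isTangle_intTangle n

/-- Control of the right face of the left summand is enough for sums: of the right summand only
containment in the cube is then needed. -/
theorem eq_of_mem_intTangle {n : ℤ} {p : ℝ × ℝ × ℝ} (hp : p ∈ intTangle n) (h : p.1 = 1 / 2) :
    p = NE ∨ p = SE := by
  obtain ⟨t, ht, ε, hε, rfl⟩ := hp
  have hs : Real.sin (π * n) = 0 := by rw [mul_comm]; exact Real.sin_int_mul_pi n
  have hc : Real.cos (π * n) = (-1) ^ n := by rw [mul_comm]; exact Real.cos_int_mul_pi n
  obtain rfl : t = 1 := by simp only at h; linarith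
  rcases hε with rfl | rfl <;> rcases Int.even_or_odd n with hn | hn <;>
    norm_num [hs, hc, hn.neg_one_zpow, NE, SE]

/-! ### Sums of tangles -/

/-- The compression of the left summand. -/
def toLeft (p : ℝ × ℝ × ℝ) : ℝ × ℝ × ℝ := (p.1 / 2 - 1 / 4, p.2.1, p.2.2)

/-- The compression of the right summand. -/
def toRight (p : ℝ × ℝ × ℝ) : ℝ × ℝ × ℝ := (p.1 / 2 + 1 / 4, p.2.1, p.2.2)

theorem toLeft_injective : Function.Injective toLeft := by
  rintro ⟨x, y, z⟩ ⟨x', y', z'⟩ h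
  simp only [toLeft, Prod.mk.injEq] at h ⊢
  exact ⟨by linarith [h.1], h.2⟩

theorem toRight_injective : Function.Injective toRight := by
  rintro ⟨x, y, z⟩ ⟨x', y', z'⟩ h
  simp only [toRight, Prod.mk.injEq] at h ⊢
  exact ⟨by linarith [h.1], h.2⟩

theorem continuous_toLeft : Continuous toLeft := by unfold toLeft; fun_prop

theorem continuous_toRight : Continuous toRight := by unfold toRight; fun_prop

theorem toLeft_NE : toLeft NE = toRight NW := by norm_num [toLeft, toRight, NE, NW]

theorem toLeft_SE : toLeft SE = toRight SW := by norm_num [toLeft, toRight, SE, SW]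

theorem toLeft_NW : toLeft NW = NW := by norm_num [toLeft, NW]

theorem toLeft_SW : toLeft SW = SW := by norm_num [toLeft, SW]

theorem toRight_NE : toRight NE = NE := by norm_num [toRight, NE]

theorem toRight_SE : toRight SE = SE := by norm_num [toRight, SE]

theorem tangleAdd_subset_cube {S T : Tangle} (hS : S ⊆ cube) (hT : T ⊆ cube) :
    tangleAdd S T ⊆ cube := by
  rintro _ (⟨p, hp, rfl⟩ | ⟨p, hp, rfl⟩)
  · obtain ⟨h1, h2⟩ := hS hp
    rw [abs_le] at h1
    exact ⟨abs_le.2 ⟨by simp only; linarith [h1.1], by simp only; linarith [h1.2]⟩, h2⟩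
  · obtain ⟨h1, h2⟩ := hT hp
    rw [abs_le] at h1
    exact ⟨abs_le.2 ⟨by simp only; linarith [h1.1], by simp only; linarith [h1.2]⟩, h2⟩

/-- The two summands meet at most in the two inner end points. -/
theorem mem_toLeft_toRight {A C : Set (ℝ × ℝ × ℝ)} (hA : A ⊆ cube) (hC : C ⊆ cube)
    (hA' : ∀ p ∈ A, p.1 = 1 / 2 → p = NE ∨ p = SE) {q : ℝ × ℝ × ℝ} (h1 : q ∈ toLeft '' A)
    (h2 : q ∈ toRight '' C) :
    (q = toLeft NE ∧ NE ∈ A ∧ NW ∈ C) ∨ (q = toLeft SE ∧ SE ∈ A ∧ SW ∈ C) := by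
  obtain ⟨p, hp, rfl⟩ := h1
  obtain ⟨r, hr, h⟩ := h2
  have hpx := abs_le.1 (hA hp).1
  have hrx := abs_le.1 (hC hr).1
  have hx : r.1 / 2 + 1 / 4 = p.1 / 2 - 1 / 4 := congrArg Prod.fst h
  rcases hA' p hp (by linarith [hpx.2, hrx.1]) with rfl | rfl
  · rw [toLeft_NE] at h
    exact .inl ⟨rfl, hp, toRight_injective h ▸ hr⟩
  · rw [toLeft_SE] at h
    exact .inr ⟨rfl, hp, toRight_injective h ▸ hr⟩

theorem IsArc.mem_left {A : Set (ℝ × ℝ × ℝ)} {a b : ℝ × ℝ × ℝ} (h : IsArc id A a b) : a ∈ A :=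
  h.left_mem

theorem IsArc.mem_right {A : Set (ℝ × ℝ × ℝ)} {a b : ℝ × ℝ × ℝ} (h : IsArc id A a b) : b ∈ A :=
  h.right_mem

theorem IsArc.image {A : Set (ℝ × ℝ × ℝ)} {a b : ℝ × ℝ × ℝ} (h : IsArc id A a b)
    {k : ℝ × ℝ × ℝ → ℝ × ℝ × ℝ} (hk : Continuous k) (hi : Function.Injective k) :
    IsArc id (k '' A) (k a) (k b) :=
  h.map hi.injOn hk fun _ => rfl

/-- Each strand of `S` is continued by the strand of `T` that starts at the same gluing point. Any
other meeting would put an end point of one strand on the strand disjoint from it. -/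
theorem IsTangle.add_through {S T : Tangle} {u v p q : ℝ × ℝ × ℝ} (hS : IsTangle S u NE v SE)
    (hS' : ∀ p ∈ S, p.1 = 1 / 2 → p = NE ∨ p = SE) (hT : IsTangle T NW p SW q) :
    IsTangle (tangleAdd S T) (toLeft u) (toRight p) (toLeft v) (toRight q) := by
  obtain ⟨hSc, A, B, hA, hB, hAB, rfl⟩ := hS
  obtain ⟨hTc, C, D, hC, hD, hCD, rfl⟩ := hT
  refine ⟨tangleAdd_subset_cube hSc hTc, toLeft '' A ∪ toRight '' C, toLeft '' B ∪ toRight '' D,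
    ?_, ?_, ?_, ?_⟩
  · refine (hA.image continuous_toLeft toLeft_injective).trans
      (toLeft_NE ▸ hC.image continuous_toRight toRight_injective) ?_
    rintro x ⟨h1, h2⟩
    rcases mem_toLeft_toRight (Set.subset_union_left.trans hSc) (Set.subset_union_left.trans hTc)
      (fun p hp => hS' p (.inl hp)) h1 h2 with h | h
    · exact h.1
    · exact absurd hB.mem_right (Set.disjoint_left.1 hAB h.2.1)
  · refine (hB.image continuous_toLeft toLeft_injective).trans
      (toLeft_SE ▸ hD.image continuous_toRight toRight_injective) ?_
    rintro x ⟨h1, h2⟩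
    rcases mem_toLeft_toRight (Set.subset_union_right.trans hSc)
      (Set.subset_union_right.trans hTc) (fun p hp => hS' p (.inr hp)) h1 h2 with h | h
    · exact absurd h.2.1 (Set.disjoint_left.1 hAB hA.mem_right)
    · exact h.1
  · rw [Set.disjoint_union_left, Set.disjoint_union_right, Set.disjoint_union_right,
      Set.disjoint_image_iff toLeft_injective, Set.disjoint_image_iff toRight_injective]
    refine ⟨⟨hAB, Set.disjoint_left.2 fun x h1 h2 => ?_⟩,
      Set.disjoint_right.2 fun x h1 h2 => ?_, hCD⟩
    · rcases mem_toLeft_toRight (Set.subset_union_left.trans hSc)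
        (Set.subset_union_right.trans hTc) (fun p hp => hS' p (.inl hp)) h1 h2 with h | h
      · exact Set.disjoint_left.1 hCD hC.mem_left h.2.2
      · exact Set.disjoint_left.1 hAB h.2.1 hB.mem_right
    · rcases mem_toLeft_toRight (Set.subset_union_right.trans hSc)
        (Set.subset_union_left.trans hTc) (fun p hp => hS' p (.inr hp)) h1 h2 with h | h
      · exact Set.disjoint_left.1 hAB hA.mem_right h.2.1
      · exact Set.disjoint_left.1 hCD h.2.2 hD.mem_left
  · rw [Set.union_union_union_comm, ← Set.image_union, ← Set.image_union]
    rfl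

/-- The left strand of `T` turns back: together with both strands of `S` it forms a single strand,
and the right strand of `T` is left alone. -/
theorem IsTangle.add_vertical {S T : Tangle} {u v : ℝ × ℝ × ℝ} (hS : IsTangle S u NE v SE)
    (hS' : ∀ p ∈ S, p.1 = 1 / 2 → p = NE ∨ p = SE) (hT : IsTangle T NW SW NE SE) :
    IsTangle (tangleAdd S T) (toLeft u) (toLeft v) NE SE := by
  obtain ⟨hSc, A, B, hA, hB, hAB, rfl⟩ := hS
  obtain ⟨hTc, C, D, hC, hD, hCD, rfl⟩ := hT
  have hmeet {X Y : Set (ℝ × ℝ × ℝ)} (hX : X ⊆ A ∪ B) (hY : Y ⊆ C ∪ D) {x} :=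
    mem_toLeft_toRight (hX.trans hSc) (hY.trans hTc) (fun p hp => hS' p (hX hp)) (q := x)
  refine ⟨tangleAdd_subset_cube hSc hTc, (toLeft '' A ∪ toRight '' C) ∪ toLeft '' B, toRight '' D,
    ?_, ?_, ?_, ?_⟩
  · refine ((hA.image continuous_toLeft toLeft_injective).trans
      (toLeft_NE ▸ hC.image continuous_toRight toRight_injective) ?_).trans
      (toLeft_SE ▸ hB.symm.image continuous_toLeft toLeft_injective) ?_
    · rintro x ⟨h1, h2⟩
      rcases hmeet Set.subset_union_left Set.subset_union_left h1 h2 with h | h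
      · exact h.1
      · exact absurd hB.mem_right (Set.disjoint_left.1 hAB h.2.1)
    · rintro x ⟨h1 | h1, h2⟩
      · exact absurd h2 (Set.disjoint_left.1
          ((Set.disjoint_image_iff toLeft_injective).2 hAB) h1)
      · rcases hmeet Set.subset_union_right Set.subset_union_left h2 h1 with h | h
        · exact absurd h.2.1 (Set.disjoint_left.1 hAB hA.mem_right)
        · rw [h.1, toLeft_SE]
          rfl
  · have := hD.image continuous_toRight toRight_injective
    rwa [toRight_NE, toRight_SE] at this
  · rw [Set.disjoint_union_left, Set.disjoint_union_left,
      Set.disjoint_image_iff toRight_injective]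
    refine ⟨⟨Set.disjoint_left.2 fun x h1 h2 => ?_, hCD⟩,
      Set.disjoint_left.2 fun x h1 h2 => ?_⟩
    · rcases hmeet Set.subset_union_left Set.subset_union_right h1 h2 with h | h
      · exact Set.disjoint_left.1 hCD hC.mem_left h.2.2
      · exact Set.disjoint_left.1 hCD hC.mem_right h.2.2
    · rcases hmeet Set.subset_union_right Set.subset_union_right h1 h2 with h | h
      · exact Set.disjoint_left.1 hCD hC.mem_left h.2.2
      · exact Set.disjoint_left.1 hCD hC.mem_right h.2.2
  · rw [Set.union_right_comm (toLeft '' A), Set.union_assoc, ← Set.image_union, ← Set.image_union]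
    rfl

/-! ### Connection types of rational tangles -/

/-- The strands of `T` are connected as the parity of `r` predicts. -/
def HasParityType (T : Tangle) (r : OnePoint ℚ) : Prop :=
  (ParityOE r ∧ IsTangle T NW SW NE SE) ∨ (ParityEO r ∧ IsTangle T NW NE SW SE) ∨
    (ParityOO r ∧ IsTangle T NW SE SW NE)

/-- The reflection fixes `NW` and `SE` and exchanges `NE` and `SW`. -/
theorem IsTangle.inv_vertical {T : Tangle} (h : IsTangle T NW SW NE SE) :
    IsTangle (tangleInv T) NW NE SW SE := by
  have := h.inv
  norm_num [NW, NE, SW, SE] at this ⊢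
  exact this

theorem IsTangle.inv_horizontal {T : Tangle} (h : IsTangle T NW NE SW SE) :
    IsTangle (tangleInv T) NW SW NE SE := by
  have := h.inv
  norm_num [NW, NE, SW, SE] at this ⊢
  exact this

theorem IsTangle.inv_crossing {T : Tangle} (h : IsTangle T NW SE SW NE) :
    IsTangle (tangleInv T) NW SE SW NE := by
  have := h.inv.symm_right
  norm_num [NW, NE, SW, SE] at this ⊢
  exact this

/-- The quarter turn permutes the corners cyclically: `NW`, `SW`, `SE`, `NE`. -/
theorem IsTangle.turn_vertical {T : Tangle} (h : IsTangle T NW SW NE SE) :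
    IsTangle (tangleTurn T) NW NE SW SE := by
  have := h.turn.swap
  norm_num [NW, NE, SW, SE] at this ⊢
  exact this

theorem IsTangle.turn_horizontal {T : Tangle} (h : IsTangle T NW NE SW SE) :
    IsTangle (tangleTurn T) NW SW NE SE := by
  have := h.turn.symm_left.symm_right
  norm_num [NW, NE, SW, SE] at this ⊢
  exact this

theorem IsTangle.turn_crossing {T : Tangle} (h : IsTangle T NW SE SW NE) :
    IsTangle (tangleTurn T) NW SE SW NE := by
  have := h.turn.swap.symm_left
  norm_num [NW, NE, SW, SE] at this ⊢
  exact this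

theorem HasParityType.inv {T : Tangle} {r : OnePoint ℚ} (h : HasParityType T r) :
    HasParityType (tangleInv T) (fracInv r) := by
  have hr := odd_fracInv r
  simp only [HasParityType, ParityOE, ParityEO, ParityOO, ← Int.not_odd_iff_even,
    ← Nat.not_odd_iff_even, hr.1, hr.2] at h ⊢
  rcases h with ⟨h1, h⟩ | ⟨h1, h⟩ | ⟨h1, h⟩
  · exact .inr (.inl ⟨h1.symm, h.inv_vertical⟩)
  · exact .inl ⟨h1.symm, h.inv_horizontal⟩
  · exact .inr (.inr ⟨h1.symm, h.inv_crossing⟩)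

/-- For odd `a` the left corners trade places: this exchanges the horizontal and the diagonal
pattern and preserves the vertical one. For even `a` nothing changes. -/
theorem HasParityType.add {T : Tangle} {r : OnePoint ℚ} (h : HasParityType T r) (a : ℤ) :
    HasParityType (tangleAdd (intTangle a) T) (fracAdd a r) := by
  have hr := odd_fracAdd a r
  have hS' (p) (hp : p ∈ intTangle a) := eq_of_mem_intTangle hp
  simp only [HasParityType, ParityOE, ParityEO, ParityOO, ← Int.not_odd_iff_even,
    ← Nat.not_odd_iff_even, hr.1, hr.2] at h ⊢
  rcases Int.even_or_odd a with ha | ha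
  · have hS := isTangle_intTangle_even ha
    have ha' : ¬ Odd a := Int.not_odd_iff_even.2 ha
    rcases h with ⟨h1, h⟩ | ⟨h1, h⟩ | ⟨h1, h⟩
    · exact .inl ⟨by tauto, by simpa only [toLeft_NW, toLeft_SW] using hS.add_vertical hS' h⟩
    · exact .inr (.inl ⟨by tauto, by
        simpa only [toLeft_NW, toLeft_SW, toRight_NE, toRight_SE] using hS.add_through hS' h⟩)
    · exact .inr (.inr ⟨by tauto, by
        simpa only [toLeft_NW, toLeft_SW, toRight_NE, toRight_SE] using hS.add_through hS' h⟩)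
  · have hS := (isTangle_intTangle_odd ha).swap
    rcases h with ⟨h1, h⟩ | ⟨h1, h⟩ | ⟨h1, h⟩
    · exact .inl ⟨by tauto, by
        simpa only [toLeft_NW, toLeft_SW] using (hS.add_vertical hS' h).symm_left⟩
    · exact .inr (.inr ⟨by tauto, by
        simpa only [toLeft_NW, toLeft_SW, toRight_NE, toRight_SE] using
          (hS.add_through hS' h).swap⟩)
    · exact .inr (.inl ⟨by tauto, by
        simpa only [toLeft_NW, toLeft_SW, toRight_NE, toRight_SE] using
          (hS.add_through hS' h).swap⟩)

theorem hasParityType_intTangle (a : ℤ) :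
    HasParityType (intTangle a) (((a : ℚ)) : OnePoint ℚ) := by
  have h1 : fracNum (((a : ℚ)) : OnePoint ℚ) = a := by simp [fracNum]
  have h2 : fracDen (((a : ℚ)) : OnePoint ℚ) = 1 := by simp [fracDen]
  simp only [HasParityType, ParityOE, ParityEO, ParityOO, h1, h2]
  rcases Int.even_or_odd a with ha | ha
  · exact .inr (.inl ⟨⟨ha, odd_one⟩, isTangle_intTangle_even ha⟩)
  · exact .inr (.inr ⟨⟨ha, odd_one⟩, isTangle_intTangle_odd ha⟩)

theorem RationalTangle.hasParityType (R : RationalTangle) :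
    HasParityType R.toTangle R.fraction := by
  cases R with
  | infty =>
    refine .inl ⟨by simp [ParityOE, fracNum, fracDen, fraction], ?_⟩
    exact (isTangle_intTangle_even Even.zero).inv_horizontal
  | seq a₁ l =>
    -- Both left folds carry an accumulator, so the induction runs over arbitrary starting values.
    have (l : List ℤ) (T : Tangle) (r : OnePoint ℚ) (h : HasParityType T r) :
        HasParityType (l.foldl (fun T a => tangleAdd (intTangle a) (tangleInv T)) T)
          (l.foldl (fun r a => fracAdd a (fracInv r)) r) := by
      induction l generalizing T r with
      | nil => exact h
      | cons a l ih => exact ih _ _ (h.inv.add a)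
    exact this l _ _ (hasParityType_intTangle a₁)

/-! ### Closures of tangles -/

/-- The embedding of the cube in the unbounded solid torus. -/
def embed (p : ℝ × ℝ × ℝ) : Circle × ℂ := (Circle.exp (π * p.2.1), ⟨p.1, p.2.2⟩)

/-- The lift of `embed` to the covering. -/
def embedLift (p : ℝ × ℝ × ℝ) : ℝ × ℂ := (π * p.2.1, ⟨p.1, p.2.2⟩)

/-- The closing arc at distance `s` from the core. -/
def closingArc (s : ℝ) : Set (Circle × ℂ) :=
  {q | ∃ θ ∈ Set.Icc (π / 2) (3 * π / 2), q = (Circle.exp θ, (s : ℂ))}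

theorem continuous_embedLift : Continuous embedLift := by
  have : embedLift = fun p => (π * p.2.1, (p.1 : ℂ) + (p.2.2 : ℂ) * Complex.I) := by
    funext p
    rw [embedLift, Complex.mk_eq_add_mul_I]
  rw [this]
  fun_prop

theorem exp_eq_exp_of_abs_lt {s t : ℝ} (h : Circle.exp s = Circle.exp t)
    (hst : |s - t| < 2 * π) : s = t := by
  obtain ⟨m, hm⟩ := Circle.exp_eq_exp.1 h
  have h2 := Real.two_pi_pos
  have hm' : s - t = m * (2 * π) := by linarith
  rw [hm', abs_mul, abs_of_pos h2, mul_lt_iff_lt_one_left h2] at hst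
  have : |m| < 1 := by exact_mod_cast hst
  rw [Int.abs_lt_one_iff.1 this] at hm
  simpa using hm

theorem injOn_embed : Set.InjOn embed cube := by
  rintro ⟨x, y, z⟩ ⟨hx, hy, hz⟩ ⟨x', y', z'⟩ ⟨hx', hy', hz'⟩ h
  simp only [embed, Prod.mk.injEq, Complex.mk.injEq] at h ⊢
  refine ⟨h.2.1, ?_, h.2.2⟩
  have hπ := Real.pi_pos
  refine mul_left_cancel₀ hπ.ne' (exp_eq_exp_of_abs_lt h.1 ?_)
  rw [← mul_sub, abs_mul, abs_of_pos hπ]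
  simp only [abs_le] at hy hy'
  have : |y - y'| < 2 := abs_lt.2 ⟨by linarith, by linarith⟩
  nlinarith

theorem isArc_closingArc (s : ℝ) :
    IsArc cover (closingArc s) (π / 2, (s : ℂ)) (3 * π / 2, (s : ℂ)) := by
  have hπ := Real.pi_pos
  refine ⟨⟨⟨fun t => (π / 2 + t * π, (s : ℂ)), by fun_prop⟩, ?_, ?_⟩, ?_, ?_⟩
  · simp
  · ext
    · simp; ring
    · simp
  · intro t t' h
    simp only [cover, Path.coe_mk_mk, Function.comp_apply, Prod.mk.injEq, and_true] at h
    have h1 := t.2.1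
    have h2 := t.2.2
    have h3 := t'.2.1
    have h4 := t'.2.2
    have := exp_eq_exp_of_abs_lt h (abs_lt.2 ⟨by nlinarith, by nlinarith⟩)
    exact Subtype.ext (mul_right_cancel₀ hπ.ne' (by linarith))
  · ext q
    constructor
    · rintro ⟨t, rfl⟩
      refine ⟨π / 2 + t * π, ⟨?_, ?_⟩, rfl⟩
      · nlinarith [t.2.1]
      · nlinarith [t.2.2]
    · rintro ⟨θ, hθ, rfl⟩
      refine ⟨⟨(θ - π / 2) / π, div_nonneg (by linarith [hθ.1]) hπ.le,
        (div_le_one hπ).2 (by linarith [hθ.2])⟩, ?_⟩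
      simp only [cover, Path.coe_mk_mk, Function.comp_apply, Prod.mk.injEq, and_true]
      congr 1
      field_simp
      ring

/-- A deck transformation: it lets a piece be appended to a lift that has already passed to the next
sheet. -/
theorem IsArc.shift {A : Set (Circle × ℂ)} {a b : ℝ × ℂ} (h : IsArc cover A a b) :
    IsArc cover A (a.1 + 2 * π, a.2) (b.1 + 2 * π, b.2) := by
  have := h.map (p' := cover) (k := id) Function.injective_id.injOn
    (j := fun q => (q.1 + 2 * π, q.2)) (by fun_prop) (fun y => by simp [cover])
  rwa [Set.image_id] at this

theorem IsArc.embed {A : Set (ℝ × ℝ × ℝ)} {a b : ℝ × ℝ × ℝ} (h : IsArc id A a b)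
    (hA : A ⊆ cube) : IsArc cover (embed '' A) (embedLift a) (embedLift b) :=
  h.map (injOn_embed.mono hA) continuous_embedLift fun _ => rfl

theorem norm_le_of_mem_embed {A : Set (ℝ × ℝ × ℝ)} (hA : A ⊆ cube) {q : Circle × ℂ}
    (hq : q ∈ embed '' A) : ‖q.2‖ ≤ 1 := by
  obtain ⟨p, hp, rfl⟩ := hq
  refine (Complex.norm_le_abs_re_add_abs_im _).trans ?_
  have := hA hp
  change |p.1| + |p.2.2| ≤ 1
  linarith [this.1, this.2.2]

theorem norm_le_of_mem_closingArc {s : ℝ} (hs : |s| = 1 / 2) {q : Circle × ℂ}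
    (hq : q ∈ closingArc s) : ‖q.2‖ ≤ 1 := by
  obtain ⟨θ, -, rfl⟩ := hq
  rw [Complex.norm_real, Real.norm_eq_abs, hs]
  norm_num

theorem disjoint_closingArc {s t : ℝ} (hst : s ≠ t) :
    Disjoint (closingArc s) (closingArc t) := by
  refine Set.disjoint_left.2 ?_
  rintro _ ⟨θ, -, rfl⟩ ⟨θ', -, h⟩
  simp only [Prod.mk.injEq, Complex.ofReal_inj] at h
  exact hst h.2

/-- The closing arcs meet the tangle at most in its end points. -/
theorem mem_embed_closingArc {A : Set (ℝ × ℝ × ℝ)} (hA : A ⊆ cube) {s : ℝ} {q : Circle × ℂ}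
    (h1 : q ∈ embed '' A) (h2 : q ∈ closingArc s) :
    (q = embed (s, 1 / 2, 0) ∧ (s, 1 / 2, 0) ∈ A) ∨
      (q = embed (s, -1 / 2, 0) ∧ (s, -1 / 2, 0) ∈ A) := by
  obtain ⟨⟨x, y, z⟩, hp, rfl⟩ := h1
  obtain ⟨θ, hθ, h⟩ := h2
  simp only [SolidTorus.embed, Prod.mk.injEq, Complex.ext_iff, Complex.ofReal_re,
    Complex.ofReal_im] at h
  obtain ⟨h, rfl, rfl⟩ := h
  obtain ⟨-, hy, -⟩ := hA hp
  have hπ := Real.pi_pos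
  simp only [abs_le] at hy
  have h1 := hθ.1
  have h2 := hθ.2
  -- Only at `θ = 3 * π / 2` can the two angles differ by a full turn, so this end is treated apart.
  rcases eq_or_lt_of_le h2 with h2 | h2
  · right
    have h' : Circle.exp (π * y) = Circle.exp (θ - 2 * π) := by
      rw [h, Circle.exp_sub, Circle.exp_two_pi, div_one]
    have := exp_eq_exp_of_abs_lt h' (abs_lt.2 ⟨by nlinarith, by nlinarith⟩)
    obtain rfl : y = -1 / 2 := mul_left_cancel₀ hπ.ne' (by linarith)
    exact ⟨rfl, hp⟩
  · left
    have := exp_eq_exp_of_abs_lt h (abs_lt.2 ⟨by nlinarith, by nlinarith⟩)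
    obtain rfl : y = 1 / 2 := le_antisymm hy.2 (le_of_mul_le_mul_left (by linarith) hπ)
    exact ⟨rfl, hp⟩

theorem verticalClosure_eq {T : Tangle} :
    verticalClosure T = inclusion ⁻¹'
      (embed '' T ∪ (closingArc (-1 / 2) ∪ closingArc (1 / 2))) := by
  ext v
  simp only [verticalClosure, Set.mem_ofPred_eq, Set.mem_preimage, Set.mem_union, Set.mem_image,
    closingArc, inclusion, embed, Prod.mk.injEq]
  refine or_congr ?_ ?_
  · exact exists_congr fun p => and_congr_right fun _ => and_congr eq_comm eq_comm
  · push_cast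
    constructor
    · rintro ⟨θ, hθ, h1, h2 | h2⟩
      · exact .inl ⟨θ, hθ, h1, h2⟩
      · exact .inr ⟨θ, hθ, h1, h2⟩
    · rintro (⟨θ, hθ, h1, h2⟩ | ⟨θ, hθ, h1, h2⟩)
      · exact ⟨θ, hθ, h1, .inl h2⟩
      · exact ⟨θ, hθ, h1, .inr h2⟩

theorem mem_embed_leftArc {A : Set (ℝ × ℝ × ℝ)} (hA : A ⊆ cube) {q : Circle × ℂ}
    (h1 : q ∈ embed '' A) (h2 : q ∈ closingArc (-1 / 2)) :
    (q = embed NW ∧ NW ∈ A) ∨ (q = embed SW ∧ SW ∈ A) := mem_embed_closingArc hA h1 h2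

theorem mem_embed_rightArc {A : Set (ℝ × ℝ × ℝ)} (hA : A ⊆ cube) {q : Circle × ℂ}
    (h1 : q ∈ embed '' A) (h2 : q ∈ closingArc (1 / 2)) :
    (q = embed NE ∧ NE ∈ A) ∨ (q = embed SE ∧ SE ∈ A) := mem_embed_closingArc hA h1 h2

theorem embedLift_NW : embedLift NW = (π / 2, ((-1 / 2 : ℝ) : ℂ)) := by
  simp [embedLift, NW, Complex.ext_iff]; ring

theorem embedLift_NE : embedLift NE = (π / 2, ((1 / 2 : ℝ) : ℂ)) := by
  simp [embedLift, NE, Complex.ext_iff]; ring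

theorem embedLift_SW : embedLift SW = (-π / 2, ((-1 / 2 : ℝ) : ℂ)) := by
  simp [embedLift, SW, Complex.ext_iff]; ring

theorem embedLift_SE : embedLift SE = (-π / 2, ((1 / 2 : ℝ) : ℂ)) := by
  simp [embedLift, SE, Complex.ext_iff]; ring

theorem cover_add_two_pi (θ : ℝ) (w : ℂ) : cover (θ + 2 * π, w) = cover (θ, w) := by
  simp [cover]

theorem isArc_leftArc : IsArc cover (closingArc (-1 / 2)) (embedLift NW)
    ((embedLift SW).1 + 2 * π, (embedLift SW).2) := by
  rw [embedLift_NW, embedLift_SW]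
  convert isArc_closingArc (-1 / 2) using 2
  simp only; ring

theorem isArc_rightArc : IsArc cover (closingArc (1 / 2)) (embedLift NE)
    ((embedLift SE).1 + 2 * π, (embedLift SE).2) := by
  rw [embedLift_NE, embedLift_SE]
  convert isArc_closingArc (1 / 2) using 2
  simp only; ring

/-- Each strand, run upwards, takes the angle from `-π / 2` to `π / 2`, and the closing arc on its
side continues to `3 * π / 2`: one full turn. -/
theorem IsTangle.isLoops {T : Tangle} (h : IsTangle T NW SW NE SE) :
    ∃ L M, IsLoop L 1 ∧ IsLoop M 1 ∧ Disjoint L M ∧ L ∪ M = verticalClosure T := by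
  obtain ⟨hT, A, B, hA, hB, hAB, rfl⟩ := h
  have hAT : A ⊆ cube := Set.subset_union_left.trans hT
  have hBT : B ⊆ cube := Set.subset_union_right.trans hT
  refine ⟨inclusion ⁻¹' (embed '' A ∪ closingArc (-1 / 2)),
    inclusion ⁻¹' (embed '' B ∪ closingArc (1 / 2)), ?_, ?_, ?_, ?_⟩
  · refine IsClosedArc.isLoop (s := (embedLift SW).1) (w := (embedLift SW).2)
      ((hA.symm.embed hAT).close isArc_leftArc (cover_add_two_pi _ _).symm ?_) ?_ rfl (by simp)
    · rintro q ⟨h1, h2⟩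
      rcases mem_embed_leftArc hAT h1 h2 with h | h
      · exact .inr h.1
      · exact .inl h.1
    · rintro q (h | h)
      · exact norm_le_of_mem_embed hAT h
      · exact norm_le_of_mem_closingArc (by norm_num [abs_of_neg]) h
  · refine IsClosedArc.isLoop (s := (embedLift SE).1) (w := (embedLift SE).2)
      ((hB.symm.embed hBT).close isArc_rightArc (cover_add_two_pi _ _).symm ?_) ?_ rfl (by simp)
    · rintro q ⟨h1, h2⟩
      rcases mem_embed_rightArc hBT h1 h2 with h | h
      · exact .inr h.1
      · exact .inl h.1
    · rintro q (h | h)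
      · exact norm_le_of_mem_embed hBT h
      · exact norm_le_of_mem_closingArc (by norm_num) h
  · refine Disjoint.preimage _ ?_
    rw [Set.disjoint_union_left, Set.disjoint_union_right, Set.disjoint_union_right]
    refine ⟨⟨hAB.image injOn_embed hAT hBT, Set.disjoint_left.2 fun q h1 h2 => ?_⟩,
      Set.disjoint_right.2 fun q h1 h2 => ?_, disjoint_closingArc (by norm_num)⟩
    · rcases mem_embed_rightArc hAT h1 h2 with h | h
      · exact Set.disjoint_left.1 hAB h.2 hB.mem_left
      · exact Set.disjoint_left.1 hAB h.2 hB.mem_right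
    · rcases mem_embed_leftArc hBT h1 h2 with h | h
      · exact Set.disjoint_left.1 hAB hA.mem_left h.2
      · exact Set.disjoint_left.1 hAB hA.mem_right h.2
  · rw [verticalClosure_eq, ← Set.preimage_union, Set.union_union_union_comm, ← Set.image_union]

theorem norm_le_of_mem_closure {A B : Set (ℝ × ℝ × ℝ)} (hA : A ⊆ cube) (hB : B ⊆ cube) :
    ∀ q ∈ ((embed '' A ∪ closingArc (1 / 2)) ∪ embed '' B) ∪ closingArc (-1 / 2),
      ‖q.2‖ ≤ 1 := by
  rintro q (((h | h) | h) | h)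
  · exact norm_le_of_mem_embed hA h
  · exact norm_le_of_mem_closingArc (by norm_num) h
  · exact norm_le_of_mem_embed hB h
  · exact norm_le_of_mem_closingArc (by norm_num [abs_of_neg]) h

theorem verticalClosure_union {A B : Set (ℝ × ℝ × ℝ)} :
    verticalClosure (A ∪ B) = inclusion ⁻¹'
      (((embed '' A ∪ closingArc (1 / 2)) ∪ embed '' B) ∪ closingArc (-1 / 2)) := by
  rw [verticalClosure_eq, Set.image_union]
  ext v
  simp only [Set.mem_preimage, Set.mem_union]
  tauto

/-- Tour `NW`, `NE`, `SE`, `SW`, `NW`: at these corners the lifted angle is `π / 2`, `π / 2`, `3 * π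
/ 2`, `3 * π / 2`, `π / 2`. The left arc undoes the right one. -/
theorem IsTangle.isLoop_horizontal {T : Tangle} (h : IsTangle T NW NE SW SE) :
    IsLoop (verticalClosure T) 0 := by
  obtain ⟨hT, A, B, hA, hB, hAB, rfl⟩ := h
  have hAT : A ⊆ cube := Set.subset_union_left.trans hT
  have hBT : B ⊆ cube := Set.subset_union_right.trans hT
  rw [verticalClosure_union]
  refine IsClosedArc.isLoop (s := (embedLift NW).1) (w := (embedLift NW).2)
    (((((hA.embed hAT).trans isArc_rightArc ?_).trans (hB.symm.embed hBT).shift ?_)).close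
      isArc_leftArc.symm rfl ?_) (norm_le_of_mem_closure hAT hBT) rfl (by simp)
  · rintro q ⟨h1, h2⟩
    rcases mem_embed_rightArc hAT h1 h2 with h | h
    · exact h.1
    · exact absurd hB.mem_right (Set.disjoint_left.1 hAB h.2)
  · rintro q ⟨h1 | h1, h2⟩
    · exact absurd h2 (Set.disjoint_left.1 (hAB.image injOn_embed hAT hBT) h1)
    · rw [cover_add_two_pi]
      rcases mem_embed_rightArc hBT h2 h1 with h | h
      · exact absurd h.2 (Set.disjoint_left.1 hAB hA.mem_right)
      · exact h.1
  · rw [cover_add_two_pi]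
    rintro q ⟨(h1 | h1) | h1, h2⟩
    · rcases mem_embed_leftArc hAT h1 h2 with h | h
      · exact .inl h.1
      · exact .inr h.1
    · exact absurd h2 (Set.disjoint_left.1 (disjoint_closingArc (by norm_num)) h1)
    · rcases mem_embed_leftArc hBT h1 h2 with h | h
      · exact .inl h.1
      · exact .inr h.1

/-- Tour `SW`, `NE`, `SE`, `NW`, `SW`: each of the four pieces raises the lifted angle by `π`, from
`-π / 2` to `7 * π / 2`. -/
theorem IsTangle.isLoop_crossing {T : Tangle} (h : IsTangle T NW SE SW NE) :
    IsLoop (verticalClosure T) 2 := by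
  obtain ⟨hT, A, B, hA, hB, hAB, rfl⟩ := h.swap
  have hAT : A ⊆ cube := Set.subset_union_left.trans hT
  have hBT : B ⊆ cube := Set.subset_union_right.trans hT
  rw [verticalClosure_union]
  refine IsClosedArc.isLoop (s := (embedLift SW).1) (w := (embedLift SW).2)
    (((((hA.embed hAT).trans isArc_rightArc ?_).trans (hB.symm.embed hBT).shift ?_)).close
      isArc_leftArc.shift ?_ ?_) (norm_le_of_mem_closure hAT hBT) rfl ?_
  · rintro q ⟨h1, h2⟩
    rcases mem_embed_rightArc hAT h1 h2 with h | h
    · exact h.1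
    · exact absurd hB.mem_right (Set.disjoint_left.1 hAB h.2)
  · rintro q ⟨h1 | h1, h2⟩
    · exact absurd h2 (Set.disjoint_left.1 (hAB.image injOn_embed hAT hBT) h1)
    · rw [cover_add_two_pi]
      rcases mem_embed_rightArc hBT h2 h1 with h | h
      · exact absurd h.2 (Set.disjoint_left.1 hAB hA.mem_right)
      · exact h.1
  · rw [cover_add_two_pi, cover_add_two_pi]
  · rw [cover_add_two_pi]
    rintro q ⟨(h1 | h1) | h1, h2⟩
    · rcases mem_embed_leftArc hAT h1 h2 with h | h
      · exact .inr h.1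
      · exact .inl h.1
    · exact absurd h2 (Set.disjoint_left.1 (disjoint_closingArc (by norm_num)) h1)
    · rcases mem_embed_leftArc hBT h1 h2 with h | h
      · exact .inr h.1
      · exact .inl h.1
  · ext
    · simp only; push_cast; ring
    · rfl

theorem IsTangle.twoCores {T : Tangle} (h : IsTangle T NW SW NE SE) :
    IsLinkOfHomotopyType (verticalClosure T) twoCores := by
  obtain ⟨L, M, hL, hM, hLM, hT⟩ := h.isLoops
  have := IsLinkOfHomotopyType.of_loops (n := 2) (ℓ := ![L, M]) (d := fun _ => 1)
    (by simp [Fin.forall_fin_two, hL, hM]) ?_ SolidTorus.twoCores (fun q => (zpow_one _).symm)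
  · convert this
    rw [← hT]
    ext v
    simp [Fin.exists_fin_two]
  · intro i j hij
    fin_cases i <;> fin_cases j <;> first | exact absurd rfl hij | exact hLM | exact hLM.symm

theorem IsLoop.isLinkOfHomotopyType {L : Set V} {d : ℤ} (h : IsLoop L d)
    (γ₀ : C(Fin 1 × Circle, V)) (hγ : ∀ q, (γ₀ q).1 = q.2 ^ d) : IsLinkOfHomotopyType L γ₀ := by
  have := IsLinkOfHomotopyType.of_loops (n := 1) (ℓ := fun _ => L) (d := fun _ => d)
    (fun _ => h) (fun i j hij => absurd (Subsingleton.elim i j) hij) γ₀ hγ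
  rwa [Set.iUnion_const] at this

theorem IsTangle.trivialKnot {T : Tangle} (h : IsTangle T NW NE SW SE) :
    IsLinkOfHomotopyType (verticalClosure T) trivialKnot :=
  h.isLoop_horizontal.isLinkOfHomotopyType _ fun _ => (zpow_zero _).symm

theorem IsTangle.crossingKnot {T : Tangle} (h : IsTangle T NW SE SW NE) :
    IsLinkOfHomotopyType (verticalClosure T) crossingKnot :=
  h.isLoop_crossing.isLinkOfHomotopyType _ fun _ => (zpow_ofNat _ 2).symm

theorem not_parityOE_and_parityEO {r : OnePoint ℚ} (h : ParityOE r) : ¬ ParityEO r :=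
  fun h' => Int.not_even_iff_odd.2 h.1 h'.1

theorem not_parityOE_and_parityOO {r : OnePoint ℚ} (h : ParityOE r) : ¬ ParityOO r :=
  fun h' => Nat.not_even_iff_odd.2 h'.2 h.2

theorem not_parityEO_and_parityOO {r : OnePoint ℚ} (h : ParityEO r) : ¬ ParityOO r :=
  fun h' => Int.not_even_iff_odd.2 h'.1 h.1

/-- Three mutually exclusive homotopy types, one of which is present, match three mutually
exclusive propositions, one of which is the corresponding one. -/
theorem homotopyType_iff {L : Set V} {P Q R : Prop}
    (h : (P ∧ IsLinkOfHomotopyType L twoCores) ∨ (Q ∧ IsLinkOfHomotopyType L trivialKnot) ∨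
      (R ∧ IsLinkOfHomotopyType L crossingKnot))
    (hPQ : P → ¬ Q) (hPR : P → ¬ R) (hQR : Q → ¬ R) :
    (IsLinkOfHomotopyType L twoCores ↔ P) ∧ (IsLinkOfHomotopyType L trivialKnot ↔ Q) ∧
      (IsLinkOfHomotopyType L crossingKnot ↔ R) := by
  have h1 : IsLinkOfHomotopyType L trivialKnot → ¬ IsLinkOfHomotopyType L twoCores :=
    fun h h' => h.false_of_one_two h'
  have h2 : IsLinkOfHomotopyType L crossingKnot → ¬ IsLinkOfHomotopyType L twoCores :=
    fun h h' => h.false_of_one_two h'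
  have h3 : IsLinkOfHomotopyType L trivialKnot → ¬ IsLinkOfHomotopyType L crossingKnot :=
    fun h h' => h.false_of_trivial_crossing h'
  tauto

end SolidTorus

end

theorem mainTheorem9 (R : SolidTorus.RationalTangle) (L : Set SolidTorus.V) :
    (SolidTorus.AmbientIsotopic (SolidTorus.verticalClosure R.toTangle) L →
      (SolidTorus.IsLinkOfHomotopyType L SolidTorus.twoCores ↔ SolidTorus.ParityOE R.fraction) ∧
      (SolidTorus.IsLinkOfHomotopyType L SolidTorus.trivialKnot ↔
        SolidTorus.ParityEO R.fraction) ∧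
      (SolidTorus.IsLinkOfHomotopyType L SolidTorus.crossingKnot ↔
        SolidTorus.ParityOO R.fraction)) ∧
    (SolidTorus.AmbientIsotopic (SolidTorus.horizontalClosure R.toTangle) L →
      (SolidTorus.IsLinkOfHomotopyType L SolidTorus.twoCores ↔ SolidTorus.ParityEO R.fraction) ∧
      (SolidTorus.IsLinkOfHomotopyType L SolidTorus.trivialKnot ↔
        SolidTorus.ParityOE R.fraction) ∧
      (SolidTorus.IsLinkOfHomotopyType L SolidTorus.crossingKnot ↔
        SolidTorus.ParityOO R.fraction)) := by
  open SolidTorus in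
  constructor <;> intro h <;> rw [← h.isLinkOfHomotopyType_iff, ← h.isLinkOfHomotopyType_iff,
    ← h.isLinkOfHomotopyType_iff]
  · refine homotopyType_iff ?_ not_parityOE_and_parityEO not_parityOE_and_parityOO
      not_parityEO_and_parityOO
    rcases R.hasParityType with ⟨h1, h⟩ | ⟨h1, h⟩ | ⟨h1, h⟩
    · exact .inl ⟨h1, h.twoCores⟩
    · exact .inr (.inl ⟨h1, h.trivialKnot⟩)
    · exact .inr (.inr ⟨h1, h.crossingKnot⟩)
  -- The quarter turn exchanges the vertical and horizontal patterns, so the first two parities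
  -- change roles.
  · refine homotopyType_iff ?_ (fun h h' => not_parityOE_and_parityEO h' h)
      not_parityEO_and_parityOO not_parityOE_and_parityOO
    rcases R.hasParityType with ⟨h1, h⟩ | ⟨h1, h⟩ | ⟨h1, h⟩
    · exact .inr (.inl ⟨h1, h.turn_vertical.trivialKnot⟩)
    · exact .inl ⟨h1, h.turn_horizontal.twoCores⟩
    · exact .inr (.inr ⟨h1, h.turn_crossing.crossingKnot⟩)
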